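/- Let $H$ be a finite graph. An $H$-partite graph is a finite graph $G$ together with a partition $V(G)=\bigsqcup_{x\in V(H)}V_x$ and a weight function $w:V(G)\to[0,1]$ such that $\sum_{v\in V_x}w(v)=1$ for every $x\in V(H)$, and such that every edge of $G$ joins a vertex of $V_x$ to a vertex of $V_y$ for some edge $xy\in E(H)$. If $H$ has at least one edge, the $H$-partite density of $G$ is $$d_H(G)=\min_{xy\in E(H)}\ \sum_{u\in V_x,\,v\in V_y,\,uv\in E(G)}w(u)w(v).$$ A transversal of $G$ is a subgraph of $G$ induced by a set of vertices containing exactly one vertex from each part $V_x$. For a family $\mathcal F$ of finite graphs, let $$\pi_H(\mathcal F)=\sup\{d_H(G): G\text{ is an }H\text{-partite graph none of whose transversals contains a copy of a member of }\mathcal F\text{ as a (not necessarily induced) subgraph}\},$$ and write $\pi_H(F)=\pi_H(\{F\})$. Let $C_r$ and $P_r$ denote the cycle and the path on $r$ vertices, and let $\mathcal T_r$ be the family of all trees on $r$ vertices. Then for every integer $r\ge 4$, $$\frac{3-\tan^2\left(\frac{\pi}{\lfloor r/2\rfloor+2}\right)}{4}\ \le\ \pi_{C_r}(\mathcal T_r)=\pi_{C_r}(P_r)\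 \le\ \frac{3-\tan^2\left(\frac{\pi}{r+2}\right)}{4}.$$ -/

import Mathlib

open scoped Classical in
/-- A (weighted, finite) `H`-partite graph: a finite graph `graph` on `V` with a canonical partition
of `V` into parts indexed by the vertices of `H` (the part of `x` being the fibre `part v = x`),
a weight function with values in `[0,1]` whose sum over each part is `1`, and such that every edge
joins two parts indexed by adjacent vertices of `H`. -/
structure HPartiteGraph {W : Type} (H : SimpleGraph W) where
  V : Type
  [fintypeV : Fintype V]
  graph : SimpleGraph V
  part : V → W
  weight : V → ℝ
  weight_mem : ∀ v, weight v ∈ Set.Icc (0 : ℝ) 1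
  sum_weight : ∀ x : W, ∑ v : V with part v = x, weight v = 1
  adj_part : ∀ u v : V, graph.Adj u v → H.Adj (part u) (part v)

namespace HPartiteGraph

attribute [instance] HPartiteGraph.fintypeV

variable {W : Type} {H : SimpleGraph W}

open scoped Classical in
/-- The edge density of the weighted bipartite graph between the parts of `x` and `y`. -/
noncomputable def edgeDensity (G : HPartiteGraph H) (x y : W) : ℝ :=
  ∑ u : G.V with G.part u = x, ∑ v : G.V with G.part v = y,
    if G.graph.Adj u v then G.weight u * G.weight v else 0

/-- The `H`-partite density: the minimum of the edge densities over the edges of `H`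
(for a finite host graph `H` with at least one edge, the infimum is a minimum). -/
noncomputable def density (G : HPartiteGraph H) : ℝ :=
  sInf {α : ℝ | ∃ x y : W, H.Adj x y ∧ α = G.edgeDensity x y}

/-- A vertex set meeting each part in exactly one vertex. The corresponding transversal
is the induced subgraph `G.graph.induce U`. -/
def IsTransversal (G : HPartiteGraph H) (U : Set G.V) : Prop :=
  ∀ x : W, ∃! v : G.V, v ∈ U ∧ G.part v = x

/-- No transversal contains a copy (as a not necessarily induced subgraph)
of a member of the family `𝓕` of finite graphs. -/
def HasFreeTransversals (G : HPartiteGraph H) (𝓕 : Set (Σ n : ℕ, SimpleGraph (Fin n))) : Prop :=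
  ∀ U : Set G.V, G.IsTransversal U → ∀ F ∈ 𝓕, F.2.Free (G.graph.induce U)

end HPartiteGraph

/-- The set of densities of `H`-partite graphs with `𝓕`-free transversals. -/
def freeDensities {W : Type} (H : SimpleGraph W) (𝓕 : Set (Σ n : ℕ, SimpleGraph (Fin n))) :
    Set ℝ :=
  {d : ℝ | ∃ G : HPartiteGraph H, G.HasFreeTransversals 𝓕 ∧ d = G.density}

/-- The partite Turán density `π_H(𝓕)`. -/
noncomputable def partiteTuranDensity {W : Type} (H : SimpleGraph W)
    (𝓕 : Set (Σ n : ℕ, SimpleGraph (Fin n))) : ℝ :=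
  sSup (freeDensities H 𝓕)

/-- The family of all trees on `r` vertices. -/
def treeFamily (r : ℕ) : Set (Σ n : ℕ, SimpleGraph (Fin n)) :=
  {F | F.1 = r ∧ F.2.IsTree}

/-- The family whose only member is the path on `r` vertices. -/
def pathFamily (r : ℕ) : Set (Σ n : ℕ, SimpleGraph (Fin n)) :=
  {⟨r, SimpleGraph.pathGraph r⟩}

/-- Edge densities are non-negative. -/
theorem HPartiteGraph.edgeDensity_nonneg {W : Type} {H : SimpleGraph W} (G : HPartiteGraph H)
    (x y : W) : 0 ≤ G.edgeDensity x y := by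
  classical
  unfold HPartiteGraph.edgeDensity
  refine Finset.sum_nonneg fun u _ => Finset.sum_nonneg fun v _ => ?_
  split_ifs
  · exact mul_nonneg (G.weight_mem u).1 (G.weight_mem v).1
  · exact le_rfl

/-- Edge densities are at most `1`. -/
theorem HPartiteGraph.edgeDensity_le_one {W : Type} {H : SimpleGraph W} (G : HPartiteGraph H)
    (x y : W) : G.edgeDensity x y ≤ 1 := by
  classical
  have key : G.edgeDensity x y ≤ ∑ u : G.V with G.part u = x, ∑ v : G.V with G.part v = y,
      G.weight u * G.weight v := by
    unfold HPartiteGraph.edgeDensity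
    refine Finset.sum_le_sum fun u _ => Finset.sum_le_sum fun v _ => ?_
    split_ifs
    · exact le_rfl
    · exact mul_nonneg (G.weight_mem u).1 (G.weight_mem v).1
  have h : ∑ u : G.V with G.part u = x, ∑ v : G.V with G.part v = y,
      G.weight u * G.weight v = 1 := by
    rw [← Finset.sum_mul_sum, G.sum_weight, G.sum_weight, one_mul]
  exact key.trans h.le

/-- The supremum defining `π_H(𝓕)` is over a set that is bounded above. -/
theorem freeDensities_bddAbove {W : Type} (H : SimpleGraph W)
    (𝓕 : Set (Σ n : ℕ, SimpleGraph (Fin n))) : BddAbove (freeDensities H 𝓕) := by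
  refine ⟨1, ?_⟩
  rintro d ⟨G, -, rfl⟩
  unfold HPartiteGraph.density
  by_cases h : ∃ x y, H.Adj x y
  · obtain ⟨x, y, hxy⟩ := h
    have hb : BddBelow {α : ℝ | ∃ x y : W, H.Adj x y ∧ α = G.edgeDensity x y} := by
      refine ⟨0, ?_⟩
      rintro _ ⟨a, b, -, rfl⟩
      exact G.edgeDensity_nonneg a b
    exact (csInf_le hb ⟨x, y, hxy, rfl⟩).trans (G.edgeDensity_le_one x y)
  · have he : {α : ℝ | ∃ x y : W, H.Adj x y ∧ α = G.edgeDensity x y} = ∅ := by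
      ext α
      refine ⟨fun ⟨x, y, hxy, _⟩ => (h ⟨x, y, hxy⟩).elim, fun hα => hα.elim⟩
    rw [he, Real.sInf_empty]
    exact zero_le_one

/-- That set is also non-empty if all members of the family have an edge. -/
theorem freeDensities_nonempty {W : Type} [Fintype W] (H : SimpleGraph W)
    (𝓕 : Set (Σ n : ℕ, SimpleGraph (Fin n))) (h𝓕 : ∀ F ∈ 𝓕, F.2 ≠ ⊥) :
    (freeDensities H 𝓕).Nonempty := by
  classical
  refine ⟨_, ⟨{ V := W, graph := ⊥, part := id, weight := fun _ => 1,
                weight_mem := fun _ => by simp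
                sum_weight := fun x => by
                  have hx : (Finset.univ.filter fun v : W => id v = x) = {x} := by ext; simp
                  convert Finset.sum_singleton (fun _ : W => (1 : ℝ)) x
                adj_part := fun u v h => by simp at h }, ?_, rfl⟩⟩
  rintro U - F hF ⟨f⟩
  obtain ⟨a, b, hab⟩ := SimpleGraph.ne_bot_iff_exists_adj.mp (h𝓕 F hF)
  have := f.toHom.map_adj hab
  simp at this

/-! A transversal has one vertex per part, so it is a subgraph of the cycle `C_r` on all `r`
vertices. A copy of any tree on `r` vertices makes it connected, hence missing at most one cycle
edge, hence containing `P_r`. Both families therefore exclude the same thing, `HasTransversalPath`.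

Both bounds rest on the recursion `x₀ = 1`, `xᵢ (1 - xᵢ₊₁) = 1 / (4 cos² θ)`, solved by `sinRatio
θ`; for `θ = π / (m + 2)` it stays positive until it vanishes at `i = m`.

Upper bound (`m = r`): vertices reached by paths from part `0` have no edges to unreached vertices
of the next part. If every density is at least `1 - 1 / (4 cos² θ)`, the reached weight in part `i`
is at least `xᵢ`, which is still positive at `i = r - 1`.

Lower bound (`m = ⌊r/2⌋`): fold the cycle onto a path by distance to `0`, and split each part at
distance `i` into weights `xᵢ` and `1 - xᵢ`, deleting the edges from the first piece to the second
piece one step farther out. Removing one cycle edge leaves intact one of the two arcs from distance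
`0` to distance `m`; a path along it would have to stay in the first pieces, the last of which has
weight `0`. -/

/-! ### Connected transversals of a cycle -/

open SimpleGraph Finset in
theorem card_edgeSet_le_of_le_cycleGraph {n : ℕ} (K : SimpleGraph (Fin (n + 2)))
    [DecidableRel K.Adj] (hK : K ≤ cycleGraph (n + 2)) :
    Nat.card K.edgeSet ≤ #{a : Fin (n + 2) | K.Adj a (a + 1)} := by
  have hsub : K.edgeSet ⊆
      (({a : Fin (n + 2) | K.Adj a (a + 1)} : Finset _).image fun a => s(a, a + 1) :
        Finset (Sym2 (Fin (n + 2)))) := by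
    intro e
    induction e using Sym2.ind with
    | _ u v =>
      intro h
      rw [mem_edgeSet] at h
      simp only [coe_image, coe_filter, mem_univ, true_and, Set.mem_image, Set.mem_ofPred_eq]
      rcases cycleGraph_adj.1 (hK h) with h1 | h1
      · obtain rfl : u = v + 1 := by rw [← h1]; abel
        exact ⟨v, h.symm, Sym2.eq_swap⟩
      · obtain rfl : v = u + 1 := by rw [← h1]; abel
        exact ⟨u, h, rfl⟩
  calc Nat.card K.edgeSet = K.edgeSet.ncard := rfl
    _ ≤ _ := Set.ncard_le_ncard hsub
    _ ≤ _ := by rw [Set.ncard_coe_finset]; exact card_image_le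

open SimpleGraph Finset in
theorem exists_adj_add_one_of_connected {n : ℕ} {K : SimpleGraph (Fin (n + 2))}
    (hK : K ≤ cycleGraph (n + 2)) (hc : K.Connected) :
    ∃ j, ∀ a ≠ j, K.Adj a (a + 1) := by
  classical
  by_contra! h
  obtain ⟨a, -, ha⟩ := h 0
  obtain ⟨b, hba, hb⟩ := h a
  have hsub : ({a : Fin (n + 2) | K.Adj a (a + 1)} : Finset _) ⊆ (univ.erase a).erase b := by
    intro c hc
    simp only [mem_filter, mem_univ, true_and] at hc
    simp only [mem_erase, mem_univ, and_true]
    exact ⟨fun h => hb (h ▸ hc), fun h => ha (h ▸ hc)⟩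
  have h1 := (card_edgeSet_le_of_le_cycleGraph K hK).trans (card_le_card hsub)
  rw [card_erase_of_mem (by simp [hba]), card_erase_of_mem (mem_univ _), card_univ,
    Fintype.card_fin] at h1
  have h2 := hc.card_vert_le_card_edgeSet_add_one
  rw [Nat.card_eq_fintype_card, Fintype.card_fin] at h2
  omega

-- The path lies in the cycle and misses its closing edge, so it has at most `n + 1` edges. For `n =
-- 0` the closing edge coincides with the path's own edge and this count fails.
open SimpleGraph Finset in
theorem isTree_pathGraph {n : ℕ} (hn : 1 ≤ n) : (pathGraph (n + 2)).IsTree := by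
  classical
  have hc := pathGraph_connected (n + 1)
  refine isTree_iff_connected_and_card.2
    ⟨hc, le_antisymm ?_ hc.card_vert_le_card_edgeSet_add_one⟩
  have hsub : ({a : Fin (n + 2) | (pathGraph (n + 2)).Adj a (a + 1)} : Finset _) ⊆
      univ.erase (Fin.last (n + 1)) := by
    intro c hc
    simp only [mem_filter, mem_univ, true_and] at hc
    simp only [mem_erase, mem_univ, and_true]
    rintro rfl
    rw [pathGraph_adj] at hc
    simp at hc
    omega
  have h1 := (card_edgeSet_le_of_le_cycleGraph _ pathGraph_le_cycleGraph).trans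
    (card_le_card hsub)
  rw [card_erase_of_mem (mem_univ _), card_univ, Fintype.card_fin] at h1
  rw [Nat.card_fin]
  omega

namespace HPartiteGraph

open SimpleGraph

/-- Some transversal contains all but at most one of the edges of the host cycle. -/
def HasTransversalPath {n : ℕ} (G : HPartiteGraph (cycleGraph (n + 2))) : Prop :=
  ∃ f : Fin (n + 2) → G.V, (∀ x, G.part (f x) = x) ∧
    ∃ j, ∀ a ≠ j, G.graph.Adj (f a) (f (a + 1))

theorem HasTransversalPath.exists_isContained {n : ℕ} {G : HPartiteGraph (cycleGraph (n + 2))}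
    (h : G.HasTransversalPath) :
    ∃ U, G.IsTransversal U ∧ pathGraph (n + 2) ⊑ G.graph.induce U := by
  obtain ⟨f, hf, j, hj⟩ := h
  -- Start at `j + 1`, just past the possibly missing edge, and go once around.
  refine ⟨Set.range f, fun x => ⟨f x, ⟨⟨x, rfl⟩, hf x⟩, ?_⟩, ⟨⟨⟨fun i => ⟨f (j + 1 + i), _, rfl⟩,
    ?_⟩, ?_⟩⟩⟩
  · rintro _ ⟨⟨y, rfl⟩, hy⟩
    rw [hf] at hy
    rw [hy]
  · have key : ∀ a b : Fin (n + 2), a.val + 1 = b.val →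
        G.graph.Adj (f (j + 1 + a)) (f (j + 1 + b)) := by
      intro a b hab
      have hlt : a.val + 1 < n + 2 := hab ▸ b.2
      have hb : b = a + 1 := by
        apply Fin.ext
        rw [Fin.val_add_one_of_lt' hlt, hab]
      rw [hb, ← add_assoc]
      apply hj
      intro h0
      rw [add_assoc, add_eq_left, add_comm 1 a] at h0
      rw [hb, h0] at hab
      simp at hab
    intro a b hab
    rcases pathGraph_adj.1 hab with h | h
    · exact key a b h
    · exact (key b a h).symm
  · intro a b hab
    have := congrArg (fun v => G.part v.1) hab
    simpa [hf] using this

/-- Sending a vertex of the copy to its part is an injective map between sets of `n + 2` elements,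
hence surjective, so connectedness of `F` passes to the transversal. -/
theorem hasTransversalPath_of_isContained {n : ℕ} {G : HPartiteGraph (cycleGraph (n + 2))}
    {U : Set G.V} (hU : G.IsTransversal U) {F : SimpleGraph (Fin (n + 2))} (hF : F.Connected)
    (h : F ⊑ G.graph.induce U) : G.HasTransversalPath := by
  obtain ⟨φ⟩ := h
  choose f hf hfu using hU
  simp only at hfu
  have hfφ : ∀ i, f (G.part (φ i).1) = (φ i).1 := fun i =>
    (hfu _ _ ⟨(φ i).2, rfl⟩).symm
  have hle : G.graph.comap f ≤ cycleGraph (n + 2) := by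
    intro a b hab
    have := G.adj_part _ _ hab
    rwa [(hf a).2, (hf b).2] at this
  let ψ : F →g G.graph.comap f := ⟨fun i => G.part (φ i).1, fun {a b} hab => by
    change G.graph.Adj _ _
    rw [hfφ, hfφ]
    exact φ.toHom.map_adj hab⟩
  have hinj : Function.Injective ψ := by
    intro a b hab
    apply φ.injective
    apply Subtype.ext
    change (φ a).1 = (φ b).1
    rw [← hfφ a, ← hfφ b]
    exact congrArg f hab
  exact ⟨f, fun x => (hf x).2,
    exists_adj_add_one_of_connected hle (hF.map ψ (Finite.injective_iff_surjective.1 hinj))⟩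

theorem hasFreeTransversals_pathFamily {n : ℕ} (G : HPartiteGraph (cycleGraph (n + 2))) :
    G.HasFreeTransversals (pathFamily (n + 2)) ↔ ¬ G.HasTransversalPath := by
  constructor
  · intro h hp
    obtain ⟨U, hU, hc⟩ := hp.exists_isContained
    exact h U hU _ rfl hc
  · rintro h U hU _ rfl hc
    exact h (hasTransversalPath_of_isContained hU (pathGraph_connected _) hc)

theorem hasFreeTransversals_treeFamily {n : ℕ} (hn : 1 ≤ n)
    (G : HPartiteGraph (cycleGraph (n + 2))) :
    G.HasFreeTransversals (treeFamily (n + 2)) ↔ ¬ G.HasTransversalPath := by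
  constructor
  · intro h hp
    obtain ⟨U, hU, hc⟩ := hp.exists_isContained
    exact h U hU ⟨n + 2, pathGraph (n + 2)⟩ ⟨rfl, isTree_pathGraph hn⟩ hc
  · rintro h U hU ⟨m, F⟩ ⟨hm, hF⟩ hc
    obtain rfl : m = n + 2 := hm
    exact h (hasTransversalPath_of_isContained hU hF.connected hc)

/-! ### Edge density and weights of vertex sets -/

variable {W : Type} {H : SimpleGraph W}

theorem density_le_edgeDensity (G : HPartiteGraph H) {x y : W} (h : H.Adj x y) :
    G.density ≤ G.edgeDensity x y :=
  csInf_le ⟨0, by rintro _ ⟨a, b, -, rfl⟩; exact G.edgeDensity_nonneg a b⟩ ⟨x, y, h, rfl⟩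

open scoped Classical in
/-- The total weight of the vertices in the part of `x` satisfying `P`. -/
noncomputable def partWeight (G : HPartiteGraph H) (x : W) (P : G.V → Prop) : ℝ :=
  ∑ u : G.V with G.part u = x, if P u then G.weight u else 0

theorem partWeight_eq_one (G : HPartiteGraph H) {x : W} {P : G.V → Prop}
    (h : ∀ v, G.part v = x → P v) : G.partWeight x P = 1 := by
  classical
  rw [partWeight, ← G.sum_weight x]
  exact Finset.sum_congr rfl fun v hv => if_pos (h v (Finset.mem_filter.1 hv).2)

theorem partWeight_eq_zero (G : HPartiteGraph H) {x : W} {P : G.V → Prop}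
    (h : ∀ v, ¬ P v) : G.partWeight x P = 0 :=
  Finset.sum_eq_zero fun v _ => if_neg (h v)

open Finset in
/-- Missing edges between subsets of two parts bound the edge density. -/
theorem edgeDensity_add_mul_le_one (G : HPartiteGraph H) (x y : W) (P Q : G.V → Prop)
    (h : ∀ u v, G.part u = x → G.part v = y → P u → G.graph.Adj u v → Q v) :
    G.edgeDensity x y + G.partWeight x P * (1 - G.partWeight y Q) ≤ 1 := by
  classical
  have h1 : 1 - G.partWeight y Q =
      ∑ v : G.V with G.part v = y, if Q v then 0 else G.weight v := by
    rw [partWeight, ← G.sum_weight y, ← sum_sub_distrib]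
    exact sum_congr rfl fun v _ => by split_ifs <;> simp
  have h2 : ∑ u : G.V with G.part u = x, ∑ v : G.V with G.part v = y,
      G.weight u * G.weight v = 1 := by
    rw [← sum_mul_sum, G.sum_weight, G.sum_weight, one_mul]
  rw [h1, partWeight, sum_mul_sum, edgeDensity, ← sum_add_distrib, ← h2]
  refine sum_le_sum fun u hu => ?_
  rw [← sum_add_distrib]
  refine sum_le_sum fun v hv => ?_
  have hpos := mul_nonneg (G.weight_mem u).1 (G.weight_mem v).1
  have := h u v (by simpa using hu) (by simpa using hv)
  by_cases hP : P u <;> by_cases hQ : Q v <;> by_cases hA : G.graph.Adj u v <;>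
    simp_all

end HPartiteGraph

/-! ### The trigonometric recursion -/

theorem three_sub_tan_sq {θ : ℝ} (h : Real.cos θ ≠ 0) :
    (3 - Real.tan θ ^ 2) / 4 = 1 - 1 / (4 * Real.cos θ ^ 2) := by
  have := Real.sin_sq_add_cos_sq θ
  rw [Real.tan_eq_sin_div_cos]
  field_simp
  linarith

/-- The ratio of consecutive normalized Chebyshev values,
solving `x 0 = 1`, `x (i + 1) = 1 - 1 / (4 cos² θ x i)`. -/
noncomputable def sinRatio (θ : ℝ) (i : ℕ) : ℝ :=
  Real.sin ((i + 2) * θ) / (2 * Real.cos θ * Real.sin ((i + 1) * θ))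

theorem sinRatio_zero {θ : ℝ} (hc : Real.cos θ ≠ 0) (hs : Real.sin θ ≠ 0) :
    sinRatio θ 0 = 1 := by
  simp only [sinRatio, Nat.cast_zero, zero_add, one_mul, Real.sin_two_mul]
  field_simp

theorem sinRatio_mul {θ : ℝ} {i : ℕ} (hc : Real.cos θ ≠ 0)
    (h1 : Real.sin ((i + 1) * θ) ≠ 0) (h2 : Real.sin ((i + 2) * θ) ≠ 0) :
    sinRatio θ i * (1 - sinRatio θ (i + 1)) = 1 / (4 * Real.cos θ ^ 2) := by
  have e : Real.sin ((i + 3) * θ) =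
      2 * Real.cos θ * Real.sin ((i + 2) * θ) - Real.sin ((i + 1) * θ) := by
    have e3 : ((i : ℝ) + 3) * θ = (i + 2) * θ + θ := by ring
    have e1 : ((i : ℝ) + 1) * θ = (i + 2) * θ - θ := by ring
    rw [e3, e1, Real.sin_add, Real.sin_sub]
    ring
  have a1 : ((i + 1 : ℕ) : ℝ) + 2 = i + 3 := by push_cast; ring
  have a2 : ((i + 1 : ℕ) : ℝ) + 1 = i + 2 := by push_cast; ring
  rw [sinRatio, sinRatio, a1, a2, e]
  generalize Real.sin ((i + 1) * θ) = x at *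
  generalize Real.sin ((i + 2) * θ) = y at *
  field_simp
  ring

theorem sin_mul_pi_div_pos {m : ℕ} {t : ℝ} (h0 : 0 < t) (h : t < m + 2) :
    0 < Real.sin (t * (Real.pi / (m + 2))) := by
  have hm : (0 : ℝ) < m + 2 := by positivity
  have hpi := Real.pi_pos
  apply Real.sin_pos_of_pos_of_lt_pi (by positivity)
  rw [mul_div_assoc', div_lt_iff₀ hm]
  nlinarith

theorem cos_pi_div_pos {m : ℕ} (h : 1 ≤ m) : 0 < Real.cos (Real.pi / (m + 2)) := by
  have hpi := Real.pi_pos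
  have hm : (1 : ℝ) ≤ m := by exact_mod_cast h
  apply Real.cos_pos_of_mem_Ioo
  constructor
  · have : 0 < Real.pi / ((m : ℝ) + 2) := by positivity
    linarith
  · apply div_lt_div_of_pos_left hpi <;> linarith

theorem sinRatio_pos {m i : ℕ} (hm : 1 ≤ m) (h : i < m) :
    0 < sinRatio (Real.pi / (m + 2)) i := by
  have hi : (i : ℝ) < m := by exact_mod_cast h
  have hi0 : (0 : ℝ) ≤ i := by positivity
  have := cos_pi_div_pos hm
  have h1 := sin_mul_pi_div_pos (m := m) (t := i + 1) (by linarith) (by linarith)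
  have h2 := sin_mul_pi_div_pos (m := m) (t := i + 2) (by linarith) (by linarith)
  unfold sinRatio
  positivity

theorem sinRatio_self (m : ℕ) : sinRatio (Real.pi / (m + 2)) m = 0 := by
  have hm : (m : ℝ) + 2 ≠ 0 := by positivity
  rw [sinRatio, mul_div_cancel₀ _ hm, Real.sin_pi, zero_div]

theorem sinRatio_pi_div_zero {m : ℕ} (hm : 1 ≤ m) : sinRatio (Real.pi / (m + 2)) 0 = 1 := by
  have h1 := sin_mul_pi_div_pos (m := m) (t := 1) (by norm_num)
    (by have : (0 : ℝ) ≤ m := by positivity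
        linarith)
  rw [one_mul] at h1
  exact sinRatio_zero (cos_pi_div_pos hm).ne' h1.ne'

theorem sinRatio_pi_div_mul {m i : ℕ} (hm : 1 ≤ m) (h : i < m) :
    sinRatio (Real.pi / (m + 2)) i * (1 - sinRatio (Real.pi / (m + 2)) (i + 1)) =
      1 / (4 * Real.cos (Real.pi / (m + 2)) ^ 2) := by
  have hi : (i : ℝ) < m := by exact_mod_cast h
  have hi0 : (0 : ℝ) ≤ i := by positivity
  exact sinRatio_mul (cos_pi_div_pos hm).ne'
    (sin_mul_pi_div_pos (m := m) (t := i + 1) (by linarith) (by linarith)).ne'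
    (sin_mul_pi_div_pos (m := m) (t := i + 2) (by linarith) (by linarith)).ne'

theorem sinRatio_mem_Icc {m i : ℕ} (hm : 1 ≤ m) (h : i ≤ m) :
    sinRatio (Real.pi / (m + 2)) i ∈ Set.Icc (0 : ℝ) 1 := by
  constructor
  · rcases h.lt_or_eq with h | rfl
    · exact (sinRatio_pos hm h).le
    · exact (sinRatio_self _).ge
  -- A value above `1` would make the left side of the recursion negative.
  · rcases i with _ | i
    · exact (sinRatio_pi_div_zero hm).le
    · have hp := sinRatio_pos hm (i := i) (by omega)
      have he := sinRatio_pi_div_mul hm (i := i) (by omega)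
      have : 0 ≤ 1 / (4 * Real.cos (Real.pi / (m + 2)) ^ 2) := by positivity
      by_contra! hlt
      nlinarith

/-! ### The upper bound: growing a path greedily -/

namespace HPartiteGraph

open SimpleGraph

/-- `v` is the last vertex of a path through the parts `0, 1, …, i`. -/
def Reaches {n : ℕ} (G : HPartiteGraph (cycleGraph (n + 2))) (i : ℕ) (v : G.V) : Prop :=
  ∃ g : ℕ → G.V, g i = v ∧ (∀ t ≤ i, G.part (g t) = Fin.ofNat (n + 2) t) ∧
    ∀ t < i, G.graph.Adj (g t) (g (t + 1))

theorem Reaches.step {n : ℕ} {G : HPartiteGraph (cycleGraph (n + 2))} {i : ℕ} {u v : G.V}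
    (h : G.Reaches i u) (huv : G.graph.Adj u v) (hv : G.part v = Fin.ofNat (n + 2) (i + 1)) :
    G.Reaches (i + 1) v := by
  obtain ⟨g, hgi, hp, ha⟩ := h
  refine ⟨fun t => if t ≤ i then g t else v, by simp, fun t ht => ?_, fun t ht => ?_⟩
  · rcases Nat.le_succ_iff.1 ht with h | rfl
    · simp [h, hp t h]
    · simpa using hv
  · rcases Nat.lt_succ_iff_lt_or_eq.1 ht with h | rfl
    · simp [h.le, Nat.succ_le_of_lt h, ha t h]
    · simpa [hgi] using huv

theorem Reaches.hasTransversalPath {n : ℕ} {G : HPartiteGraph (cycleGraph (n + 2))} {v : G.V}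
    (h : G.Reaches (n + 1) v) : G.HasTransversalPath := by
  obtain ⟨g, -, hp, ha⟩ := h
  refine ⟨fun x => g x, fun x => ?_, Fin.last _, fun a hane => ?_⟩
  · rw [hp x (by omega), Fin.ofNat_val_eq_self]
  · have hlt : a.val + 1 < n + 2 := by
      have : a.val ≠ n + 1 := fun h => hane (Fin.ext h)
      omega
    change G.graph.Adj (g a) (g (a + 1 : Fin (n + 2)))
    rw [Fin.val_add_one_of_lt' hlt]
    exact ha a (by omega)

/-- By `Reaches.step`, all pairs from the reached set of part `i` to the unreached set of part `i +
1` are non-edges; the density bound caps their weight by `1 / (4 cos² θ)`, and `sinRatio` is the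
case of equality. -/
theorem sinRatio_le_partWeight_reaches {n : ℕ} (G : HPartiteGraph (cycleGraph (n + 2)))
    (hd : 1 - 1 / (4 * Real.cos (Real.pi / ((n + 2 : ℕ) + 2)) ^ 2) ≤ G.density) (i : ℕ)
    (hi : i ≤ n + 1) :
    sinRatio (Real.pi / ((n + 2 : ℕ) + 2)) i ≤
      G.partWeight (Fin.ofNat (n + 2) i) (G.Reaches i) := by
  induction i with
  | zero =>
    rw [sinRatio_pi_div_zero (by omega), G.partWeight_eq_one fun v hv =>
      ⟨fun _ => v, rfl, fun t ht => by rwa [Nat.le_zero.1 ht], by simp⟩]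
  | succ i ih =>
    have ih := ih (by omega)
    have hadj : (cycleGraph (n + 2)).Adj (Fin.ofNat (n + 2) i) (Fin.ofNat (n + 2) (i + 1)) := by
      rw [cycleGraph_adj, sub_eq_iff_eq_add', sub_eq_iff_eq_add']
      right
      apply Fin.ext
      simp [Fin.val_add]
    have h1 := G.edgeDensity_add_mul_le_one (Fin.ofNat (n + 2) i) (Fin.ofNat (n + 2) (i + 1))
      (G.Reaches i) (G.Reaches (i + 1)) fun u v _ hv hu huv => hu.step huv hv
    have h2 := G.density_le_edgeDensity hadj
    have h3 := sinRatio_pi_div_mul (m := n + 2) (i := i) (by omega) (by omega)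
    have h4 := sinRatio_pos (m := n + 2) (i := i) (by omega) (by omega)
    have h5 := (sinRatio_mem_Icc (m := n + 2) (i := i + 1) (by omega) (by omega)).2
    by_contra! hlt
    have h6 := mul_le_mul_of_nonneg_right ih (sub_nonneg.2 (hlt.le.trans h5))
    have h7 := mul_lt_mul_of_pos_left (sub_lt_sub_left hlt 1) h4
    linarith

theorem hasTransversalPath_of_le_density {n : ℕ} (G : HPartiteGraph (cycleGraph (n + 2)))
    (hd : 1 - 1 / (4 * Real.cos (Real.pi / ((n + 2 : ℕ) + 2)) ^ 2) ≤ G.density) :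
    G.HasTransversalPath := by
  by_contra hno
  have h := G.sinRatio_le_partWeight_reaches hd (n + 1) le_rfl
  rw [G.partWeight_eq_zero fun v hv => hno hv.hasTransversalPath] at h
  exact absurd (sinRatio_pos (m := n + 2) (i := n + 1) (by omega) (by omega)) h.not_gt

end HPartiteGraph

/-! ### The lower bound: folding the cycle -/

/-- Distance to `0` along a cycle of length `r`. -/
def foldIndex {r : ℕ} (v : Fin r) : ℕ := min v.val (r - v.val)

theorem foldIndex_le {r : ℕ} (v : Fin r) : foldIndex v ≤ r / 2 := by
  unfold foldIndex; omega

/-- Equality occurs only on the edge opposite `0` in an odd cycle. -/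
theorem foldIndex_add_one {n : ℕ} (v : Fin (n + 2)) :
    foldIndex (v + 1) = foldIndex v ∨ foldIndex (v + 1) = foldIndex v + 1 ∨
      foldIndex v = foldIndex (v + 1) + 1 := by
  have hv := v.2
  unfold foldIndex
  rw [Fin.val_add_one]
  split_ifs with h
  · rw [h, Fin.val_last]
    omega
  · omega

theorem foldIndex_of_adj {n : ℕ} {u v : Fin (n + 2)}
    (h : (SimpleGraph.cycleGraph (n + 2)).Adj u v) :
    foldIndex v = foldIndex u ∨ foldIndex v = foldIndex u + 1 ∨
      foldIndex u = foldIndex v + 1 := by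
  rcases SimpleGraph.cycleGraph_adj.1 h with h | h
  · obtain rfl : u = v + 1 := by rw [← h]; abel
    have := foldIndex_add_one v
    omega
  · obtain rfl : v = u + 1 := by rw [← h]; abel
    exact foldIndex_add_one u

/-- The weight of the vertex labelled `true` in the part of `v` of the folded construction. -/
noncomputable def foldWeight {r : ℕ} (v : Fin r) : ℝ :=
  sinRatio (Real.pi / ((r / 2 : ℕ) + 2)) (foldIndex v)

theorem foldWeight_mem_Icc {n : ℕ} (v : Fin (n + 2)) : foldWeight v ∈ Set.Icc (0 : ℝ) 1 :=
  sinRatio_mem_Icc (by omega) (foldIndex_le v)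

theorem foldWeight_mul {n : ℕ} {u v : Fin (n + 2)} (h : foldIndex v = foldIndex u + 1) :
    foldWeight u * (1 - foldWeight v) =
      1 / (4 * Real.cos (Real.pi / (((n + 2) / 2 : ℕ) + 2)) ^ 2) := by
  have hv := foldIndex_le v
  rw [foldWeight, foldWeight, h]
  exact sinRatio_pi_div_mul (by omega) (by omega)

/-- The weight function of the folded construction. -/
noncomputable def foldVertexWeight {r : ℕ} (a : Fin r × Bool) : ℝ :=
  if a.2 then foldWeight a.1 else 1 - foldWeight a.1

/-- The pairs left non-adjacent in the folded construction. -/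
def FoldForbidden {r : ℕ} (a b : Fin r × Bool) : Prop :=
  foldIndex b.1 = foldIndex a.1 + 1 ∧ a.2 = true ∧ b.2 = false

open scoped Classical in
theorem sum_filter_fst_eq {α : Type} [Fintype α] (x : α) (F : α × Bool → ℝ) :
    ∑ a : α × Bool with a.1 = x, F a = F (x, true) + F (x, false) := by
  rw [Finset.sum_filter, Fintype.sum_prod_type]
  simp [Finset.sum_add_distrib]

/-- The cycle folded onto a path with `(n + 2) / 2 + 1` vertices, carrying the extremal
construction for that path. -/
noncomputable def foldedGraph (n : ℕ) : HPartiteGraph (SimpleGraph.cycleGraph (n + 2)) where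
  V := Fin (n + 2) × Bool
  graph :=
    { Adj := fun a b => (SimpleGraph.cycleGraph (n + 2)).Adj a.1 b.1 ∧
        -- Isolating the vertices of weight `0` costs no density, and it is what blocks both ends of
        -- the folded path.
        (foldVertexWeight a ≠ 0 ∧ foldVertexWeight b ≠ 0) ∧
        ¬ FoldForbidden a b ∧ ¬ FoldForbidden b a
      symm := ⟨fun _ _ h => ⟨h.1.symm, h.2.1.symm, h.2.2.symm⟩⟩
      loopless := ⟨fun _ h => h.1.ne rfl⟩ }
  part := Prod.fst
  weight := foldVertexWeight
  weight_mem := fun a => by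
    have := foldWeight_mem_Icc a.1
    unfold foldVertexWeight
    split_ifs
    · exact this
    · exact ⟨by linarith [this.2], by linarith [this.1]⟩
  sum_weight := fun x => by
    classical
    refine (sum_filter_fst_eq x foldVertexWeight).trans ?_
    simp [foldVertexWeight]
  adj_part := fun _ _ h => h.1

open scoped Classical in
theorem foldedGraph_adj_weight {n : ℕ} {a b : Fin (n + 2) × Bool}
    (h : (SimpleGraph.cycleGraph (n + 2)).Adj a.1 b.1) :
    (if (foldedGraph n).graph.Adj a b then foldVertexWeight a * foldVertexWeight b else 0) =
      if FoldForbidden a b ∨ FoldForbidden b a then 0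
        else foldVertexWeight a * foldVertexWeight b := by
  by_cases ha : foldVertexWeight a = 0
  · simp [ha]
  by_cases hb : foldVertexWeight b = 0
  · simp [hb]
  by_cases hf : FoldForbidden a b ∨ FoldForbidden b a
  · rw [if_pos hf, if_neg fun h => hf.elim h.2.2.1 h.2.2.2]
  · rw [if_neg hf, if_pos ⟨h, ⟨ha, hb⟩, not_or.1 hf⟩]

theorem edgeDensity_foldedGraph {n : ℕ} {x y : Fin (n + 2)}
    (h : (SimpleGraph.cycleGraph (n + 2)).Adj x y) :
    1 - 1 / (4 * Real.cos (Real.pi / (((n + 2) / 2 : ℕ) + 2)) ^ 2) ≤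
      (foldedGraph n).edgeDensity x y := by
  classical
  have hw : ∀ b c : Bool, (if (foldedGraph n).graph.Adj (x, b) (y, c) then
      (foldedGraph n).weight (x, b) * (foldedGraph n).weight (y, c) else 0) = _ :=
    fun b c => foldedGraph_adj_weight (a := (x, b)) (b := (y, c)) h
  have key : (foldedGraph n).edgeDensity x y = _ :=
    (sum_filter_fst_eq x _).trans
      (congrArg₂ (· + ·) (sum_filter_fst_eq y _) (sum_filter_fst_eq y _))
  refine le_of_le_of_eq ?_ (key.trans (congrArg₂ (· + ·)
    (congrArg₂ (· + ·) (hw true true) (hw true false))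
    (congrArg₂ (· + ·) (hw false true) (hw false false)))).symm
  -- Equal indices forbid no pair, so the density is `1`; otherwise exactly one pair is forbidden,
  -- and its weight is given by `foldWeight_mul`.
  rcases foldIndex_of_adj h with h | h | h
  · trans 1
    · rw [sub_le_self_iff]
      positivity
    · simp only [FoldForbidden, foldVertexWeight, h]
      simp
      linarith
  · rw [← foldWeight_mul h]
    simp [FoldForbidden, foldVertexWeight, h, show foldIndex x ≠ foldIndex x + 1 + 1 by omega]
    linarith
  · rw [← foldWeight_mul h]
    simp [FoldForbidden, foldVertexWeight, h, show foldIndex y ≠ foldIndex y + 1 + 1 by omega]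
    linarith

theorem le_density_foldedGraph (n : ℕ) :
    1 - 1 / (4 * Real.cos (Real.pi / (((n + 2) / 2 : ℕ) + 2)) ^ 2) ≤
      (foldedGraph n).density := by
  refine le_csInf ⟨_, 0, 1, ?_, rfl⟩ ?_
  · simp [SimpleGraph.cycleGraph_adj]
  · rintro _ ⟨x, y, h, rfl⟩
    exact edgeDensity_foldedGraph h

/-- The folded construction has no path through parts of fold indices `0, 1, …, (n + 2) / 2`. -/
theorem not_exists_path_foldedGraph {n : ℕ} (g : ℕ → Fin (n + 2) × Bool)
    (hg : ∀ i ≤ (n + 2) / 2, foldIndex (g i).1 = i)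
    (ha : ∀ i < (n + 2) / 2, (foldedGraph n).graph.Adj (g i) (g (i + 1))) : False := by
  have htrue : ∀ i ≤ (n + 2) / 2, (g i).2 = true := by
    intro i
    induction i with
    | zero =>
      intro _
      by_contra h
      apply (ha 0 (by omega)).2.1.1
      have h0 := hg 0 (by omega)
      have h1 := sinRatio_pi_div_zero (m := (n + 2) / 2) (by omega)
      rw [foldVertexWeight, if_neg h, foldWeight, h0, h1, sub_self]
    | succ i ih =>
      intro hi
      by_contra h
      apply (ha i (by omega)).2.2.1
      exact ⟨by rw [hg _ hi, hg _ (by omega)], ih (by omega), by simpa using h⟩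
  obtain ⟨k, hk⟩ : ∃ k, (n + 2) / 2 = k + 1 := ⟨(n + 2) / 2 - 1, by omega⟩
  apply (ha k (by omega)).2.1.2
  have h1 := htrue (k + 1) (by omega)
  have h2 := hg (k + 1) (by omega)
  rw [foldVertexWeight, if_pos h1, foldWeight, h2, hk]
  exact sinRatio_self _

theorem not_hasTransversalPath_foldedGraph (n : ℕ) :
    ¬ (foldedGraph n).HasTransversalPath := by
  rintro ⟨f, hf, j, hj⟩
  change ∀ x, (f x).1 = x at hf
  -- If the exceptional edge lies on the arc going up from `0`, walk down through `0, r - 1, r - 2,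
  -- …`; otherwise walk up.
  by_cases hjk : j.val < (n + 2) / 2
  · refine not_exists_path_foldedGraph (fun i => f (Fin.ofNat (n + 2) (n + 2 - i)))
      (fun i hi => ?_) fun i hi => ?_
    · rw [hf, foldIndex, Fin.val_ofNat]
      rcases i with _ | i
      · simp
      · rw [Nat.mod_eq_of_lt (by omega)]
        omega
    · have e : Fin.ofNat (n + 2) (n + 2 - i) = Fin.ofNat (n + 2) (n + 2 - (i + 1)) + 1 := by
        apply Fin.ext
        have : n + 2 - i = n + 2 - (i + 1) + 1 := by omega
        simp [Fin.val_add, this]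
      change (foldedGraph n).graph.Adj (f _) (f _)
      rw [e]
      refine (hj _ fun h => ?_).symm
      have := congrArg Fin.val h
      rw [Fin.val_ofNat, Nat.mod_eq_of_lt (by omega)] at this
      omega
  · refine not_exists_path_foldedGraph (fun i => f (Fin.ofNat (n + 2) i))
      (fun i hi => ?_) fun i hi => ?_
    · rw [hf, foldIndex, Fin.val_ofNat, Nat.mod_eq_of_lt (by omega)]
      omega
    · have e : Fin.ofNat (n + 2) (i + 1) = Fin.ofNat (n + 2) i + 1 := by
        apply Fin.ext
        simp [Fin.val_add]
      change (foldedGraph n).graph.Adj (f _) (f _)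
      rw [e]
      refine hj _ fun h => ?_
      have := congrArg Fin.val h
      rw [Fin.val_ofNat, Nat.mod_eq_of_lt (by omega)] at this
      omega

theorem proposition6p5 (r : ℕ) (hr : 4 ≤ r) :
    (3 - Real.tan (Real.pi / (((r / 2 : ℕ) : ℝ) + 2)) ^ 2) / 4 ≤
        partiteTuranDensity (SimpleGraph.cycleGraph r) (treeFamily r) ∧
      partiteTuranDensity (SimpleGraph.cycleGraph r) (treeFamily r) =
        partiteTuranDensity (SimpleGraph.cycleGraph r) (pathFamily r) ∧
      partiteTuranDensity (SimpleGraph.cycleGraph r) (pathFamily r) ≤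
        (3 - Real.tan (Real.pi / ((r : ℝ) + 2)) ^ 2) / 4 := by
  obtain ⟨n, rfl⟩ : ∃ n, r = n + 2 := ⟨r - 2, by omega⟩
  rw [three_sub_tan_sq (cos_pi_div_pos (by omega)).ne',
    three_sub_tan_sq (cos_pi_div_pos (by omega)).ne']
  have hfree := (HPartiteGraph.hasFreeTransversals_treeFamily (by omega) (foldedGraph n)).2
    (not_hasTransversalPath_foldedGraph n)
  have heq : freeDensities (SimpleGraph.cycleGraph (n + 2)) (treeFamily (n + 2)) =
      freeDensities (SimpleGraph.cycleGraph (n + 2)) (pathFamily (n + 2)) := by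
    simp only [freeDensities, HPartiteGraph.hasFreeTransversals_pathFamily,
      HPartiteGraph.hasFreeTransversals_treeFamily (show 1 ≤ n by omega)]
  refine ⟨?_, congrArg sSup heq, ?_⟩
  · exact (le_density_foldedGraph n).trans
      (le_csSup (freeDensities_bddAbove _ _) ⟨_, hfree, rfl⟩)
  -- The folded graph also supplies the non-emptiness needed here.
  · refine csSup_le (heq ▸ ⟨_, _, hfree, rfl⟩) ?_
    rintro _ ⟨G, hG, rfl⟩
    by_contra! hlt
    exact G.hasFreeTransversals_pathFamily.1 hG (G.hasTransversalPath_of_le_density hlt.le)
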